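/- Let $L$ be a frame with Heyting implication $\to$. An $L$-ordered set is a set $P$ with a map $e:P\times P\to L$ such that $e(x,x)=1$, $e(x,y)\wedge e(y,z)\le e(x,z)$, and $e(x,y)\wedge e(y,x)=1$ implies $x=y$. For $A,B\in L^X$ put $\mathrm{sub}_X(A,B)=\bigwedge_{x\in X}A(x)\to B(x)$. An element $s\in P$ is the supremum $\sqcup A$ of $A\in L^P$ if $e(s,y)=\mathrm{sub}_P(A,e(-,y))$ for all $y\in P$. An $L$-subset $D\in L^P$ is directed if $\bigvee_{x}D(x)=1$ and $D(x)\wedge D(y)\le\bigvee_{z}D(z)\wedge e(x,z)\wedge e(y,z)$ for all $x,y\in P$; $P$ is an $L$-dcpo if every directed $L$-subset has a supremum. For $x\in P$ let $$\Downarrow\! x\,(y)=\bigwedge_{D} \Big(e(x,\sqcup D)\to\bigvee_{d\in P}D(d)\wedge e(y,d)\Big),$$ where $D$ ranges over the directed $L$-subsets of $P$ that have a supremum. $P$ is continuous if for every $x\in P$ the $L$-subset $\Downarrow\! x$ is directed with supremum $x$. A map $f:P\to Q$ of $L$-ordered sets is Scott continuous if for every directed $D\in L^P$ that has a supremum, the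 $L$-subset $f^{\to}(D)(y)=\bigvee_{f(x)=y}D(x)$ of $Q$ has supremum $f(\sqcup D)$. The Scott $L$-topology $\sigma_L(P)$ consists of all $A\in L^P$ such that $A(x)\wedge e(x,y)\le A(y)$ for all $x,y\in P$ and $A(\sqcup D)=\bigvee_{x}A(x)\wedge D(x)$ for every directed $D$ that has a supremum. A point of $\sigma_L(P)$ is a map $p:\sigma_L(P)\to L$ that preserves binary meets and arbitrary joins and satisfies $p(a_P)=a$ for every constant $L$-subset $a_P$, $a\in L$. The set $\mathrm{pt}_L\sigma_L(P)$ of all points carries the inclusion $L$-order $\mathrm{sub}_{\sigma_L(P)}(p,q)=\bigwedge_{A\in\sigma_L(P)}p(A)\to q(A)$, and $\eta_P:P\to\mathrm{pt}_L\sigma_L(P)$ is defined by $\eta_P(x)(A)=A(x)$. **Theorem.** Let $P$ be a continuous $L$-ordered set. Then $(\mathrm{pt}_L\sigma_L(P),\mathrm{sub}_{\sigma_L(P)})$ with $\eta_P$ is a directed completion of $P$. That is, $\mathrm{pt}_L\sigma_L(P)$ is a continuous $L$-dcpo, $\eta_P$ is Scott continuous, and for every continuous $L$-dcpo $M$ and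 every Scott continuous map $f:P\to M$ there is a unique Scott continuous map $\overline f:\mathrm{pt}_L\sigma_L(P)\to M$ with $\overline f\circ\eta_P=f$. Consequently, the category $L$-$\mathbf{CDom}$ of continuous $L$-dcpo's and Scott continuous maps is a reflective full subcategory of the category $L$-$\mathbf{CPos}$ of continuous $L$-ordered sets and Scott continuous maps. -/

import Mathlib

open CategoryTheory

universe u v w

/-- The inclusion degree `sub(A, B) = ⋀ₓ A(x) → B(x)` of two `L`-subsets of `X`. -/
def LSub {L : Type u} [Order.Frame L] {X : Type v} (A B : X → L) : L :=
  ⨅ x, A x ⇨ B x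

/-- The (forward) Zadeh extension: `f^→(A)(y) = ⋁_{f(x) = y} A(x)`. -/
def LImage {L : Type u} [Order.Frame L] {X : Type v} {Y : Type w} (f : X → Y) (A : X → L) :
    Y → L :=
  fun y => ⨆ (x : X) (_ : f x = y), A x

/-- An `L`-order on a set `P`. -/
structure LOrder (L : Type u) [Order.Frame L] (P : Type v) where
  /-- the degree to which `x` is below `y` -/
  e : P → P → L
  refl : ∀ x, e x x = ⊤
  trans : ∀ x y z, e x y ⊓ e y z ≤ e x z
  antisymm : ∀ x y, e x y ⊓ e y x = ⊤ → x = y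

namespace LOrder

variable {L : Type u} [Order.Frame L] {P : Type v} {Q : Type w}

/-- The principal lower set `↓y`, `(↓y)(x) = e(x, y)`. -/
def down (E : LOrder L P) (y : P) : P → L := fun x => E.e x y

/-- Upper sets: `A(x) ∧ e(x, y) ≤ A(y)`. -/
def IsUpper (E : LOrder L P) (A : P → L) : Prop :=
  ∀ x y, A x ⊓ E.e x y ≤ A y

/-- `x` is a supremum of the `L`-subset `A`: `e(x, y) = sub(A, ↓y)` for all `y`. -/
def IsSup (E : LOrder L P) (A : P → L) (x : P) : Prop :=
  ∀ y, E.e x y = LSub A (E.down y)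

/-- Directed `L`-subsets (nonemptiness, i.e. `⋁ₓ D(x) = 1`, included). -/
def IsDirected (E : LOrder L P) (D : P → L) : Prop :=
  (⨆ x, D x) = ⊤ ∧ ∀ x y, D x ⊓ D y ≤ ⨆ z, D z ⊓ E.e x z ⊓ E.e y z

/-- `P` is an `L`-dcpo: every directed `L`-subset has a supremum. -/
def IsDcpo (E : LOrder L P) : Prop :=
  ∀ D : P → L, E.IsDirected D → ∃ x, E.IsSup D x

/-- `wayBelow x y` is the degree to which `y` is way below `x`: the infimum, over all directed
`L`-subsets `D` that have a supremum `s`, of `e(x, s) → ⋁_d D(d) ∧ e(y, d)`. -/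
def wayBelow (E : LOrder L P) (x : P) : P → L := fun y =>
  ⨅ (D : P → L) (s : P) (_ : E.IsDirected D) (_ : E.IsSup D s),
    E.e x s ⇨ ⨆ d, D d ⊓ E.e y d

/-- Continuous `L`-ordered sets: for every `x`, the `L`-subset of elements way below `x` is
directed and has supremum `x`. -/
def IsContinuous (E : LOrder L P) : Prop :=
  ∀ x, E.IsDirected (E.wayBelow x) ∧ E.IsSup (E.wayBelow x) x

/-- Scott continuous maps: for every directed `D` with supremum `s`, the supremum of `f^→(D)`
exists and is `f s`. -/
def ScottContinuous (E : LOrder L P) (F : LOrder L Q) (f : P → Q) : Prop :=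
  ∀ (D : P → L) (s : P), E.IsDirected D → E.IsSup D s → F.IsSup (LImage f D) (f s)

/-- Scott open sets: upper sets `A` with `A(⊔D) = ⋁ₓ A(x) ∧ D(x)` for every directed `D` that has
a supremum. -/
def IsScottOpen (E : LOrder L P) (A : P → L) : Prop :=
  E.IsUpper A ∧
    ∀ (D : P → L) (s : P), E.IsDirected D → E.IsSup D s → A s = ⨆ x, A x ⊓ D x

end LOrder

/-- A (stratified) `L`-topology on `X`. -/
structure LTopology (L : Type u) [Order.Frame L] (X : Type v) where
  opens : Set (X → L)
  inf_mem : ∀ A ∈ opens, ∀ B ∈ opens, A ⊓ B ∈ opens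
  sSup_mem : ∀ S : Set (X → L), S ⊆ opens → sSup S ∈ opens
  const_mem : ∀ a : L, (fun _ => a) ∈ opens

namespace LTopology

variable {L : Type u} [Order.Frame L] {X : Type v}

/-- The type of open sets of an `L`-topology. -/
abbrev Open (T : LTopology L X) : Type (max u v) := {A : X → L // A ∈ T.opens}

/-- Binary meet of open sets. -/
def Open.inf {T : LTopology L X} (A B : T.Open) : T.Open :=
  ⟨A.1 ⊓ B.1, T.inf_mem A.1 A.2 B.1 B.2⟩

/-- Join of a family of open sets. -/
def Open.sup {T : LTopology L X} (S : Set T.Open) : T.Open :=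
  ⟨sSup (Subtype.val '' S), T.sSup_mem _ (by rintro _ ⟨A, -, rfl⟩; exact A.2)⟩

/-- The constant open sets. -/
def Open.const (T : LTopology L X) (a : L) : T.Open := ⟨fun _ => a, T.const_mem a⟩

/-- A point of `𝒪(X)`: a map `𝒪(X) → L` that preserves binary meets, arbitrary joins and the
constants (an `L`-frame homomorphism from `𝒪(X)` to `L`). -/
structure IsPoint (T : LTopology L X) (p : T.Open → L) : Prop where
  map_inf : ∀ A B : T.Open, p (A.inf B) = p A ⊓ p B
  map_sup : ∀ S : Set T.Open, p (Open.sup S) = ⨆ A ∈ S, p A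
  map_const : ∀ a : L, p (Open.const T a) = a

/-- The set `pt_L 𝒪(X)` of points. -/
abbrev Pt (T : LTopology L X) : Type (max u v) := {p : T.Open → L // T.IsPoint p}

/-- The inclusion `L`-order on `pt_L 𝒪(X)`. -/
def ptOrder (T : LTopology L X) : LOrder L T.Pt where
  e p q := LSub p.1 q.1
  refl p := by simp [LSub]
  trans p q r := by
    refine le_iInf fun A => ?_
    refine (inf_le_inf (iInf_le _ A) (iInf_le _ A)).trans ?_
    exact himp_triangle _ _ _
  antisymm p q h := by
    have h' := inf_eq_top_iff.1 h
    refine Subtype.ext (funext fun A => le_antisymm ?_ ?_)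
    · exact himp_eq_top_iff.1 (iInf_eq_top.1 h'.1 A)
    · exact himp_eq_top_iff.1 (iInf_eq_top.1 h'.2 A)

/-- The map `η_X : X → pt_L 𝒪(X)`, `x ↦ [x]`, where `[x](A) = A(x)`. -/
def eta (T : LTopology L X) (x : X) : T.Pt :=
  ⟨fun A => A.1 x,
    { map_inf := fun _ _ => rfl
      map_sup := fun S => by
        change (sSup (Subtype.val '' S) : X → L) x = _
        rw [sSup_image]
        simp only [iSup_apply]
      map_const := fun _ => rfl }⟩

end LTopology

namespace LOrder

variable {L : Type u} [Order.Frame L] {P : Type v} {Q : Type w}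

/-- The Scott `L`-topology `σ_L(P)`. -/
def scott (E : LOrder L P) : LTopology L P where
  opens := {A | E.IsScottOpen A}
  inf_mem := by
    rintro A ⟨hA, hA'⟩ B ⟨hB, hB'⟩
    refine ⟨fun x y => le_inf ?_ ?_, fun D s hD hs => le_antisymm ?_ ?_⟩
    · exact (inf_le_inf_right _ inf_le_left).trans (hA x y)
    · exact (inf_le_inf_right _ inf_le_right).trans (hB x y)
    · simp only [Pi.inf_apply]
      rw [hA' D s hD hs, hB' D s hD hs, iSup_inf_iSup]
      refine iSup_le fun ⟨x, y⟩ => ?_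
      calc A x ⊓ D x ⊓ (B y ⊓ D y) = A x ⊓ B y ⊓ (D x ⊓ D y) := by ac_rfl
        _ ≤ A x ⊓ B y ⊓ ⨆ z, D z ⊓ E.e x z ⊓ E.e y z := inf_le_inf_left _ (hD.2 x y)
        _ ≤ _ := by
          rw [inf_iSup_eq]
          refine iSup_mono fun z => ?_
          calc A x ⊓ B y ⊓ (D z ⊓ E.e x z ⊓ E.e y z)
              = (A x ⊓ E.e x z) ⊓ (B y ⊓ E.e y z) ⊓ D z := by ac_rfl
            _ ≤ _ := inf_le_inf_right _ (inf_le_inf (hA x z) (hB y z))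
    · rw [Pi.inf_apply, hA' D s hD hs, hB' D s hD hs]
      exact iSup_le fun x => le_inf
        ((inf_le_inf_right _ inf_le_left).trans (le_iSup (fun x => A x ⊓ D x) x))
        ((inf_le_inf_right _ inf_le_right).trans (le_iSup (fun x => B x ⊓ D x) x))
  sSup_mem := by
    intro S hS
    refine ⟨fun x y => ?_, fun D s hD hs => ?_⟩
    · simp only [sSup_apply, iSup_inf_eq]
      exact iSup_mono fun A => (hS A.2).1 x y
    · simp only [sSup_apply, iSup_inf_eq]
      rw [iSup_comm]
      exact iSup_congr fun A => (hS A.2).2 D s hD hs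
  const_mem := by
    intro a
    refine ⟨fun x y => inf_le_left, fun D s hD hs => ?_⟩
    rw [← inf_iSup_eq, hD.1, inf_top_eq]

/-- `(Q, j)` is a directed completion of the continuous `L`-ordered set `P`: `Q` is a continuous
`L`-dcpo, `j` is Scott continuous, and every Scott continuous map from `P` to a continuous
`L`-dcpo `M` (in the universe `w'`) factors uniquely through `j` by a Scott continuous map. -/
def IsDirectedCompletion.{w', u', v', v''} {L : Type u'} [Order.Frame L] {P : Type v'}
    {Q : Type v''} (E : LOrder L P) (F : LOrder L Q) (j : P → Q) : Prop :=
  F.IsContinuous ∧ F.IsDcpo ∧ E.ScottContinuous F j ∧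
    ∀ (M : Type w') (G : LOrder L M), G.IsContinuous → G.IsDcpo →
      ∀ f : P → M, E.ScottContinuous G f →
        ∃! g : Q → M, F.ScottContinuous G g ∧ g ∘ j = f

/-! Scott continuous maps form a category. -/

theorem IsSup.le {E : LOrder L P} {D : P → L} {s : P} (h : E.IsSup D s) (x : P) :
    D x ≤ E.e x s := by
  have h1 : (⊤ : L) = LSub D (E.down s) := by rw [← h s, E.refl]
  exact himp_eq_top_iff.1 (iInf_eq_top.1 h1.symm x)

theorem isDirected_down (E : LOrder L P) (y : P) : E.IsDirected (E.down y) :=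
  ⟨top_le_iff.1 (by rw [← E.refl y]; exact le_iSup (E.down y) y),
    fun x z => le_iSup_of_le y (by simp [down, E.refl])⟩

theorem isSup_down (E : LOrder L P) (y : P) : E.IsSup (E.down y) y := by
  intro z
  refine le_antisymm (le_iInf fun x => ?_) ?_
  · rw [le_himp_iff, inf_comm]
    exact E.trans x y z
  · refine (iInf_le _ y).trans ?_
    simp [down, E.refl]

theorem ScottContinuous.mono {E : LOrder L P} {F : LOrder L Q} {f : P → Q}
    (hf : E.ScottContinuous F f) (x y : P) : E.e x y ≤ F.e (f x) (f y) :=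
  (le_iSup₂_of_le (f := fun (a : P) (_ : f a = f x) => E.e a y) x rfl le_rfl).trans
    ((hf _ _ (E.isDirected_down y) (E.isSup_down y)).le (f x))

theorem ScottContinuous.isDirected_image {E : LOrder L P} {F : LOrder L Q} {f : P → Q}
    (hf : E.ScottContinuous F f) {D : P → L} (hD : E.IsDirected D) :
    F.IsDirected (LImage f D) := by
  have key (x : P) : D x ≤ LImage f D (f x) :=
    le_iSup₂_of_le (f := fun (a : P) (_ : f a = f x) => D a) x rfl le_rfl
  refine ⟨top_le_iff.1 ?_, fun a b => ?_⟩
  · rw [← hD.1]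
    exact iSup_le fun x => le_iSup_of_le (f x) (key x)
  · simp only [LImage, iSup_inf_eq, inf_iSup_eq]
    refine iSup₂_le fun x hx => iSup₂_le fun y hy => ?_
    subst hx hy
    refine le_trans (le_of_eq ?_) ((hD.2 x y).trans (iSup_le fun z => ?_))
    · ac_rfl
    · refine le_iSup_of_le (f z) (le_iSup₂_of_le z rfl ?_)
      exact le_trans (le_of_eq (by ac_rfl))
        (inf_le_inf (inf_le_inf_left _ (hf.mono y z)) (hf.mono x z))

theorem scottContinuous_id (E : LOrder L P) : E.ScottContinuous E id := by
  intro D s _ hs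
  have : LImage id D = D := by
    funext y
    simp [LImage]
  rw [this]
  exact hs

theorem ScottContinuous.comp.{v₃} {R : Type v₃} {E : LOrder L P} {F : LOrder L Q} {G : LOrder L R}
    {g : Q → R} {f : P → Q} (hg : F.ScottContinuous G g) (hf : E.ScottContinuous F f) :
    E.ScottContinuous G (g ∘ f) := by
  intro D s hD hs
  have : LImage (g ∘ f) D = LImage g (LImage f D) := by
    funext y
    refine le_antisymm (iSup₂_le fun x hx => ?_) (iSup₂_le fun z hz => iSup₂_le fun x hx => ?_)
    · exact le_iSup₂_of_le (f x) hx (le_iSup₂_of_le x rfl le_rfl)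
    · exact le_iSup₂_of_le x (by simp [hx, hz]) le_rfl
  rw [this]
  exact hg _ _ (hf.isDirected_image hD) (hf D s hD hs)

end LOrder

/-- Objects of `L`-**CPos**: continuous `L`-ordered sets. -/
structure LCPos (L : Type u) [Order.Frame L] : Type (max u (w + 1)) where
  carrier : Type w
  order : LOrder L carrier
  continuous : order.IsContinuous

namespace LCPos

variable {L : Type u} [Order.Frame L]

/-- Morphisms of `L`-**CPos**: Scott continuous maps. -/
@[ext]
structure Hom (P Q : LCPos.{u, w} L) : Type w where
  toFun : P.carrier → Q.carrier
  scottContinuous : P.order.ScottContinuous Q.order toFun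

instance : Category.{w} (LCPos.{u, w} L) where
  Hom := Hom
  id P := ⟨id, P.order.scottContinuous_id⟩
  comp f g := ⟨g.toFun ∘ f.toFun, g.scottContinuous.comp f.scottContinuous⟩

/-- The property of being an `L`-dcpo. -/
def isDcpo (L : Type u) [Order.Frame L] : ObjectProperty (LCPos.{u, w} L) :=
  fun P => P.order.IsDcpo

end LCPos

/-- The category `L`-**CDom** of continuous `L`-dcpo's and Scott continuous maps. -/
abbrev LCDom (L : Type u) [Order.Frame L] : Type (max u (w + 1)) :=
  (LCPos.isDcpo.{u, w} L).FullSubcategory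

/-- The inclusion functor from `L`-**CDom** to `L`-**CPos**. -/
abbrev LCDom.inclusion (L : Type u) [Order.Frame L] : LCDom.{u, w} L ⥤ LCPos.{u, w} L :=
  (LCPos.isDcpo.{u, w} L).ι

/-!
In a continuous `L`-ordered set `P`, every Scott open set `A` is the join over `y` of the open sets
`A(y) ∧ ⇑y`, where `⇑y` is the Scott open set of the elements that `y` is way below. A point `p` is
therefore determined by the directed `L`-subset `I_p(y) = p(⇑y)`: indeed
`p(A) = ⋁_y I_p(y) ∧ A(y)`, so that `p` is the supremum of `η^→(I_p)`. Since directed suprema of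
points are computed pointwise, `p ↦ I_p` preserves them. Hence `η(y)` is way below `p` at least to
the degree `I_p(y)`, which gives continuity of the space of points, and a Scott continuous map `f`
into an `L`-dcpo has `p ↦ ⊔ f^→(I_p)` as its only Scott continuous extension.
-/

section LSubset

variable {L : Type u} [Order.Frame L] {X Y Z : Type*}

/-- The join `⋁ₓ D(x) ∧ A(x)` of a family `A` of `L`-subsets of `Y` weighted by an `L`-subset `D`
of the index set, i.e. the union of the `L`-family of those `A(x)` with `x` in `D`. -/
def LJoin (D : X → L) (A : X → Y → L) : Y → L := fun y => ⨆ x, D x ⊓ A x y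

theorem inf_LSub_le (A B : X → L) (x : X) : A x ⊓ LSub A B ≤ B x :=
  (inf_le_inf_left _ (iInf_le _ x)).trans inf_himp_le

theorem le_LImage_apply (f : X → Y) (D : X → L) (x : X) : D x ≤ LImage f D (f x) :=
  le_iSup₂_of_le (f := fun a (_ : f a = f x) => D a) x rfl le_rfl

theorem LImage_le_iff {f : X → Y} {D : X → L} {B : Y → L} : LImage f D ≤ B ↔ D ≤ B ∘ f := by
  refine ⟨fun h x => (le_LImage_apply f D x).trans (h (f x)), fun h y => iSup₂_le ?_⟩
  rintro x rfl
  exact h x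

theorem LImage_id (D : X → L) : LImage id D = D := by
  funext x
  simp only [LImage, id_eq, iSup_iSup_eq_left]

theorem LImage_comp (g : Y → Z) (f : X → Y) (D : X → L) :
    LImage (g ∘ f) D = LImage g (LImage f D) :=
  eq_of_forall_ge_iff fun B => by simp only [LImage_le_iff, Function.comp_assoc]

theorem LSub_LImage (f : X → Y) (D : X → L) (B : Y → L) :
    LSub (LImage f D) B = LSub D (B ∘ f) := by
  simp only [LSub, LImage, iSup_himp_eq, Function.comp_apply]
  rw [iInf_comm]
  simp only [iInf_iInf_eq_right]

theorem LSub_LJoin (D : X → L) (A : X → Y → L) (B : Y → L) :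
    LSub (LJoin D A) B = LSub D fun x => LSub (A x) B := by
  simp only [LSub, LJoin, iSup_himp_eq, himp_iInf_eq, himp_himp]
  rw [iInf_comm]

theorem LJoin_mono_left {D D' : X → L} (h : D ≤ D') (A : X → Y → L) : LJoin D A ≤ LJoin D' A :=
  fun _ => iSup_mono fun x => inf_le_inf_right _ (h x)

theorem LJoin_mono_right (D : X → L) {A A' : X → Y → L} (h : A ≤ A') : LJoin D A ≤ LJoin D A' :=
  fun y => iSup_mono fun x => inf_le_inf_left _ (h x y)

theorem LJoin_LJoin (D : X → L) (A : X → Y → L) (B : Y → Z → L) :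
    LJoin (LJoin D A) B = LJoin D fun x => LJoin (A x) B := by
  funext z
  simp only [LJoin, iSup_inf_eq, inf_iSup_eq, inf_assoc]
  exact iSup_comm

theorem LImage_LJoin (f : Y → Z) (D : X → L) (A : X → Y → L) :
    LImage f (LJoin D A) = LJoin D fun x => LImage f (A x) := by
  funext z
  simp only [LImage, LJoin, inf_iSup_eq]
  simp only [iSup_comm (ι' := X)]

end LSubset

namespace LOrder

section Directed

variable {L : Type u} [Order.Frame L] {P Q X : Type*} {E : LOrder L P} {F : LOrder L Q}

theorem IsSup.unique {D : P → L} {s t : P} (hs : E.IsSup D s) (ht : E.IsSup D t) : s = t := by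
  refine E.antisymm s t ?_
  rw [hs t, ← ht t, ht s, ← hs s, E.refl, E.refl, inf_top_eq]

theorem isSup_LJoin_iff {D : X → L} {A : X → P → L} {j : X → P} (hA : ∀ x, E.IsSup (A x) (j x))
    {s : P} : E.IsSup (LJoin D A) s ↔ E.IsSup (LImage j D) s := by
  refine forall_congr' fun y => ?_
  rw [LSub_LJoin, LSub_LImage]
  simp only [← hA _ y]
  rfl

theorem IsDirected.iSup_inf_iSup_of_isUpper {D A B : P → L} (hD : E.IsDirected D)
    (hA : E.IsUpper A) (hB : E.IsUpper B) :
    (⨆ x, D x ⊓ A x) ⊓ ⨆ x, D x ⊓ B x = ⨆ x, D x ⊓ (A x ⊓ B x) := by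
  refine le_antisymm ?_ (le_inf (iSup_mono fun x => inf_le_inf_left _ inf_le_left)
    (iSup_mono fun x => inf_le_inf_left _ inf_le_right))
  rw [iSup_inf_iSup]
  refine iSup_le fun ⟨x, y⟩ => ?_
  calc D x ⊓ A x ⊓ (D y ⊓ B y) = D x ⊓ D y ⊓ (A x ⊓ B y) := inf_inf_inf_comm _ _ _ _
    _ ≤ (⨆ z, D z ⊓ E.e x z ⊓ E.e y z) ⊓ (A x ⊓ B y) := inf_le_inf_right _ (hD.2 x y)
    _ = ⨆ z, D z ⊓ ((A x ⊓ E.e x z) ⊓ (B y ⊓ E.e y z)) := by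
      rw [iSup_inf_eq]
      exact iSup_congr fun z => by ac_rfl
    _ ≤ ⨆ z, D z ⊓ (A z ⊓ B z) :=
      iSup_mono fun z => inf_le_inf_left _ (inf_le_inf (hA x z) (hB y z))

theorem isDirected_LJoin {D : P → L} {A : P → Q → L} (hD : E.IsDirected D)
    (hA : ∀ x, F.IsDirected (A x)) (hAE : ∀ y, E.IsUpper fun x => A x y) :
    F.IsDirected (LJoin D A) := by
  refine ⟨?_, fun y₁ y₂ => ?_⟩
  · simp only [LJoin]
    rw [iSup_comm]
    simp only [← inf_iSup_eq, (hA _).1, inf_top_eq, hD.1]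
  · calc LJoin D A y₁ ⊓ LJoin D A y₂ = ⨆ x, D x ⊓ (A x y₁ ⊓ A x y₂) :=
          hD.iSup_inf_iSup_of_isUpper (hAE y₁) (hAE y₂)
      _ ≤ ⨆ x, D x ⊓ ⨆ z, A x z ⊓ F.e y₁ z ⊓ F.e y₂ z :=
          iSup_mono fun x => inf_le_inf_left _ ((hA x).2 y₁ y₂)
      _ = ⨆ z, LJoin D A z ⊓ F.e y₁ z ⊓ F.e y₂ z := by
          simp only [LJoin, inf_iSup_eq, iSup_inf_eq, inf_assoc]
          exact iSup_comm

/-- The lower closure `↓D(y) = ⋁_d D(d) ∧ e(y, d)` of an `L`-subset `D`, the `L`-subset of elements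
below some element of `D`. -/
def lowerClosure (E : LOrder L P) (D : P → L) : P → L := LJoin D E.down

theorem IsDirected.lowerClosure {D : P → L} (hD : E.IsDirected D) :
    E.IsDirected (E.lowerClosure D) :=
  isDirected_LJoin hD E.isDirected_down fun y => E.trans y

theorem isSup_lowerClosure_iff {D : P → L} {s : P} :
    E.IsSup (E.lowerClosure D) s ↔ E.IsSup D s :=
  (isSup_LJoin_iff (j := id) E.isSup_down).trans (by rw [LImage_id])

theorem lowerClosure_inf_e_le (E : LOrder L P) (D : P → L) (x y : P) :
    E.lowerClosure D y ⊓ E.e x y ≤ E.lowerClosure D x := by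
  rw [lowerClosure, LJoin, iSup_inf_eq]
  refine iSup_mono fun d => ?_
  rw [inf_assoc, inf_comm (E.down d y)]
  exact inf_le_inf_left _ (E.trans x y d)

end Directed

section WayBelow

variable {L : Type u} [Order.Frame L] {P : Type*} (E : LOrder L P)

theorem le_wayBelow_iff {a : L} {x y : P} :
    a ≤ E.wayBelow x y ↔
      ∀ D s, E.IsDirected D → E.IsSup D s → a ⊓ E.e x s ≤ E.lowerClosure D y := by
  simp only [wayBelow, le_iInf_iff, le_himp_iff]
  rfl

variable {E} in
theorem IsSup.wayBelow_le_lowerClosure {D : P → L} {s : P} (hs : E.IsSup D s)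
    (hD : E.IsDirected D) : E.wayBelow s ≤ E.lowerClosure D := fun y => by
  simpa only [E.refl, inf_top_eq] using
    E.le_wayBelow_iff.1 (le_refl (E.wayBelow s y)) D s hD hs

theorem isUpper_wayBelow (y : P) : E.IsUpper fun x => E.wayBelow x y := by
  refine fun x x' => E.le_wayBelow_iff.2 fun D s hD hs => ?_
  rw [inf_assoc]
  exact (inf_le_inf_left _ (E.trans x x' s)).trans (E.le_wayBelow_iff.1 le_rfl D s hD hs)

theorem wayBelow_inf_e_le (x y y' : P) : E.wayBelow x y ⊓ E.e y' y ≤ E.wayBelow x y' := by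
  refine E.le_wayBelow_iff.2 fun D s hD hs => ?_
  rw [inf_right_comm]
  exact (inf_le_inf_right _ (E.le_wayBelow_iff.1 le_rfl D s hD hs)).trans
    (E.lowerClosure_inf_e_le D y' y)

theorem lowerClosure_wayBelow_le (x : P) : E.lowerClosure (E.wayBelow x) ≤ E.wayBelow x :=
  fun y => iSup_le fun z => E.wayBelow_inf_e_le x z y

theorem wayBelow_le_e (x y : P) : E.wayBelow x y ≤ E.e y x :=
  ((E.isSup_down x).wayBelow_le_lowerClosure (E.isDirected_down x) y).trans <|
    iSup_le fun z => by
      rw [inf_comm]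
      exact E.trans y z x

variable {E}

theorem wayBelow_eq_lowerClosure {D : P → L} {x : P} (hD : E.IsDirected D) (hx : E.IsSup D x)
    (h : D ≤ E.wayBelow x) : E.wayBelow x = E.lowerClosure D :=
  le_antisymm (hx.wayBelow_le_lowerClosure hD)
    ((LJoin_mono_left h E.down).trans (E.lowerClosure_wayBelow_le x))

theorem isContinuous_of_exists_le_wayBelow
    (h : ∀ x, ∃ D, E.IsDirected D ∧ E.IsSup D x ∧ D ≤ E.wayBelow x) : E.IsContinuous := by
  intro x
  obtain ⟨D, hD, hx, hle⟩ := h x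
  rw [wayBelow_eq_lowerClosure hD hx hle]
  exact ⟨hD.lowerClosure, isSup_lowerClosure_iff.2 hx⟩

theorem IsContinuous.wayBelow_interpolation (hE : E.IsContinuous) (x : P) :
    E.wayBelow x ≤ LJoin (E.wayBelow x) E.wayBelow := by
  have hD : E.IsDirected (LJoin (E.wayBelow x) E.wayBelow) :=
    isDirected_LJoin (hE x).1 (fun z => (hE z).1) E.isUpper_wayBelow
  have hx : E.IsSup (LJoin (E.wayBelow x) E.wayBelow) x := by
    rw [isSup_LJoin_iff (j := id) fun z => (hE z).2, LImage_id]
    exact (hE x).2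
  calc E.wayBelow x ≤ E.lowerClosure (LJoin (E.wayBelow x) E.wayBelow) :=
        hx.wayBelow_le_lowerClosure hD
    _ = LJoin (E.wayBelow x) fun z => E.lowerClosure (E.wayBelow z) := LJoin_LJoin _ _ _
    _ ≤ LJoin (E.wayBelow x) E.wayBelow := LJoin_mono_right _ E.lowerClosure_wayBelow_le

theorem IsContinuous.isScottOpen_wayAbove (hE : E.IsContinuous) (y : P) :
    E.IsScottOpen fun x => E.wayBelow x y := by
  refine ⟨E.isUpper_wayBelow y, fun D s hD hs => le_antisymm ?_ (iSup_le fun d =>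
    (inf_le_inf_left _ (hs.le d)).trans (E.isUpper_wayBelow y d s))⟩
  have hDs : E.wayBelow s ≤ LJoin D E.wayBelow :=
    calc E.wayBelow s ≤ LJoin (E.wayBelow s) E.wayBelow := hE.wayBelow_interpolation s
      _ ≤ LJoin (E.lowerClosure D) E.wayBelow :=
          LJoin_mono_left (hs.wayBelow_le_lowerClosure hD) _
      _ = LJoin D fun d => LJoin (E.down d) E.wayBelow := LJoin_LJoin _ _ _
      _ ≤ LJoin D E.wayBelow := LJoin_mono_right D fun d z => iSup_le fun t => by
          rw [inf_comm]
          exact E.isUpper_wayBelow z t d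
  simpa only [LJoin, inf_comm] using hDs y

end WayBelow

end LOrder

namespace LTopology

variable {L : Type u} [Order.Frame L] {X Y : Type*} {T : LTopology L X}

theorem isSup_LImage_of_coe_eq_LJoin {j : Y → T.Pt} {D : Y → L} {p : T.Pt}
    (h : p.1 = LJoin D fun y => (j y).1) : T.ptOrder.IsSup (LImage j D) p := by
  intro r
  change LSub p.1 r.1 = _
  rw [h, LSub_LJoin, LSub_LImage]
  rfl

theorem isUpper_pt_apply (A : T.Open) : T.ptOrder.IsUpper fun p => p.1 A :=
  fun p q => inf_LSub_le p.1 q.1 A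

theorem isPoint_LJoin_coe {D : T.Pt → L} (hD : T.ptOrder.IsDirected D) :
    T.IsPoint (LJoin D Subtype.val) where
  map_inf A B := by
    simp only [LJoin, fun p : T.Pt => p.2.map_inf A B]
    exact (hD.iSup_inf_iSup_of_isUpper (isUpper_pt_apply A) (isUpper_pt_apply B)).symm
  map_sup S := by
    simp only [LJoin, fun p : T.Pt => p.2.map_sup S, inf_iSup_eq]
    rw [iSup_comm]
    exact iSup_congr fun A => iSup_comm
  map_const a := by
    simp only [LJoin, fun p : T.Pt => p.2.map_const a]
    rw [← iSup_inf_eq, hD.1, top_inf_eq]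

theorem isSup_of_coe_eq_LJoin {D : T.Pt → L} {p : T.Pt} (h : p.1 = LJoin D Subtype.val) :
    T.ptOrder.IsSup D p := by
  rw [← LImage_id D]
  exact isSup_LImage_of_coe_eq_LJoin h

theorem isDcpo_ptOrder (T : LTopology L X) : T.ptOrder.IsDcpo :=
  fun _ hD => ⟨⟨_, isPoint_LJoin_coe hD⟩, isSup_of_coe_eq_LJoin rfl⟩

theorem coe_eq_LJoin_of_isSup {D : T.Pt → L} {p : T.Pt} (hD : T.ptOrder.IsDirected D)
    (hp : T.ptOrder.IsSup D p) : p.1 = LJoin D Subtype.val :=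
  congrArg Subtype.val (hp.unique (t := ⟨_, isPoint_LJoin_coe hD⟩) (isSup_of_coe_eq_LJoin rfl))

end LTopology

namespace LOrder

variable {L : Type u} [Order.Frame L] {P Q : Type*} {E : LOrder L P}

theorem scottContinuous_eta (E : LOrder L P) :
    E.ScottContinuous E.scott.ptOrder E.scott.eta := fun D s hD hs =>
  LTopology.isSup_LImage_of_coe_eq_LJoin <| funext fun A =>
    (A.2.2 D s hD hs).trans (iSup_congr fun _ => inf_comm _ _)

/-- The Scott open set `⇑y` of the elements that `y` is way below. -/
def IsContinuous.wayAbove (hE : E.IsContinuous) (y : P) : E.scott.Open :=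
  ⟨fun x => E.wayBelow x y, hE.isScottOpen_wayAbove y⟩

theorem IsContinuous.open_eq_sup_wayAbove (hE : E.IsContinuous) (A : E.scott.Open) :
    A = LTopology.Open.sup
      (Set.range fun y => (LTopology.Open.const E.scott (A.1 y)).inf (hE.wayAbove y)) := by
  refine Subtype.ext (funext fun x => ?_)
  change A.1 x = (sSup (Subtype.val '' _) : P → L) x
  rw [sSup_image, iSup_range]
  simp only [iSup_apply]
  exact A.2.2 (E.wayBelow x) x (hE x).1 (hE x).2

/-- The rounded ideal `y ↦ p(⇑y)` of `P` that corresponds to a point `p` of the Scott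
`L`-topology. -/
def IsContinuous.ideal (hE : E.IsContinuous) (p : E.scott.Pt) : P → L :=
  fun y => p.1 (hE.wayAbove y)

section Points

variable (hE : E.IsContinuous) (p : E.scott.Pt)

include hE

theorem IsContinuous.coe_pt_eq_LJoin : p.1 = LJoin (hE.ideal p) fun y => (E.scott.eta y).1 := by
  funext A
  conv_lhs => rw [hE.open_eq_sup_wayAbove A]
  rw [p.2.map_sup, iSup_range]
  refine iSup_congr fun y => ?_
  rw [p.2.map_inf, p.2.map_const, inf_comm]
  rfl

theorem IsContinuous.pt_apply (A : E.scott.Open) : p.1 A = ⨆ y, hE.ideal p y ⊓ A.1 y :=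
  congrFun (hE.coe_pt_eq_LJoin p) A

theorem IsContinuous.isDirected_ideal : E.IsDirected (hE.ideal p) := by
  refine ⟨?_, fun x y => ?_⟩
  · calc ⨆ y, hE.ideal p y = p.1 (LTopology.Open.const E.scott ⊤) := by
          simp only [hE.pt_apply p, LTopology.Open.const, inf_top_eq]
      _ = ⊤ := p.2.map_const ⊤
  · calc hE.ideal p x ⊓ hE.ideal p y = p.1 ((hE.wayAbove x).inf (hE.wayAbove y)) :=
          (p.2.map_inf _ _).symm
      _ = ⨆ z, hE.ideal p z ⊓ (E.wayBelow z x ⊓ E.wayBelow z y) := hE.pt_apply p _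
      _ ≤ ⨆ z, hE.ideal p z ⊓ E.e x z ⊓ E.e y z := iSup_mono fun z => by
          rw [inf_assoc]
          exact inf_le_inf_left _ (inf_le_inf (E.wayBelow_le_e z x) (E.wayBelow_le_e z y))

theorem IsContinuous.isDirected_LImage_eta_ideal :
    E.scott.ptOrder.IsDirected (LImage E.scott.eta (hE.ideal p)) :=
  E.scottContinuous_eta.isDirected_image (hE.isDirected_ideal p)

theorem IsContinuous.isSup_LImage_eta_ideal :
    E.scott.ptOrder.IsSup (LImage E.scott.eta (hE.ideal p)) p :=
  LTopology.isSup_LImage_of_coe_eq_LJoin (hE.coe_pt_eq_LJoin p)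

theorem IsContinuous.ideal_le_e_eta (y : P) :
    hE.ideal p y ≤ E.scott.ptOrder.e (E.scott.eta y) p :=
  (le_LImage_apply _ _ y).trans ((hE.isSup_LImage_eta_ideal p).le (E.scott.eta y))

variable {p}

theorem IsContinuous.ideal_eq_LJoin_of_isSup {D : E.scott.Pt → L}
    (hD : E.scott.ptOrder.IsDirected D) (hp : E.scott.ptOrder.IsSup D p) :
    hE.ideal p = LJoin D hE.ideal :=
  funext fun y => congrFun (LTopology.coe_eq_LJoin_of_isSup hD hp) (hE.wayAbove y)

variable (p)

theorem IsContinuous.ideal_le_wayBelow_eta (y : P) :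
    hE.ideal p y ≤ E.scott.ptOrder.wayBelow p (E.scott.eta y) := by
  refine (le_wayBelow_iff _).2 fun D s hD hs => ?_
  calc hE.ideal p y ⊓ E.scott.ptOrder.e p s ≤ hE.ideal s y := inf_LSub_le p.1 s.1 _
    _ = ⨆ q, D q ⊓ hE.ideal q y := congrFun (hE.ideal_eq_LJoin_of_isSup hD hs) y
    _ ≤ ⨆ q, D q ⊓ E.scott.ptOrder.e (E.scott.eta y) q :=
        iSup_mono fun q => inf_le_inf_left _ (hE.ideal_le_e_eta q y)

theorem IsContinuous.isContinuous_ptOrder : E.scott.ptOrder.IsContinuous :=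
  isContinuous_of_exists_le_wayBelow fun p =>
    ⟨LImage E.scott.eta (hE.ideal p), hE.isDirected_LImage_eta_ideal p,
      hE.isSup_LImage_eta_ideal p, LImage_le_iff.2 (hE.ideal_le_wayBelow_eta p)⟩

theorem IsContinuous.scottContinuous_ext {G : LOrder L Q} {g g' : E.scott.Pt → Q}
    (hg : E.scott.ptOrder.ScottContinuous G g)
    (hg' : E.scott.ptOrder.ScottContinuous G g') (h : g ∘ E.scott.eta = g' ∘ E.scott.eta) :
    g = g' := by
  funext p
  have hgp := hg _ p (hE.isDirected_LImage_eta_ideal p) (hE.isSup_LImage_eta_ideal p)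
  have hgp' := hg' _ p (hE.isDirected_LImage_eta_ideal p) (hE.isSup_LImage_eta_ideal p)
  rw [← LImage_comp] at hgp hgp'
  exact hgp.unique (h ▸ hgp')

end Points

section Extension

variable {G : LOrder L Q} {f : P → Q} (hE : E.IsContinuous) (hG : G.IsDcpo)
  (hf : E.ScottContinuous G f)

/-- The extension `p ↦ ⊔ f^→(I_p)` to the points of the Scott `L`-topology, where `I_p` is the
rounded ideal of `p`, of a Scott continuous map `f` from `P` to an `L`-dcpo. -/
noncomputable def IsContinuous.extension (p : E.scott.Pt) : Q :=
  (hG _ (hf.isDirected_image (hE.isDirected_ideal p))).choose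

theorem IsContinuous.isSup_extension (p : E.scott.Pt) :
    G.IsSup (LImage f (hE.ideal p)) (hE.extension hG hf p) :=
  (hG _ (hf.isDirected_image (hE.isDirected_ideal p))).choose_spec

theorem IsContinuous.scottContinuous_extension :
    E.scott.ptOrder.ScottContinuous G (hE.extension hG hf) := by
  intro D p hD hp
  rw [← isSup_LJoin_iff (hE.isSup_extension hG hf), ← LImage_LJoin,
    ← hE.ideal_eq_LJoin_of_isSup hD hp]
  exact hE.isSup_extension hG hf p

theorem IsContinuous.extension_comp_eta : hE.extension hG hf ∘ E.scott.eta = f :=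
  funext fun x => (hE.isSup_extension hG hf (E.scott.eta x)).unique
    (hf (E.wayBelow x) x (hE x).1 (hE x).2)

include hE hG hf in
theorem IsContinuous.existsUnique_extension :
    ∃! g : E.scott.Pt → Q, E.scott.ptOrder.ScottContinuous G g ∧ g ∘ E.scott.eta = f :=
  ⟨hE.extension hG hf, ⟨hE.scottContinuous_extension hG hf, hE.extension_comp_eta hG hf⟩,
    fun _ hg => hE.scottContinuous_ext hg.1 (hE.scottContinuous_extension hG hf)
      (hg.2.trans (hE.extension_comp_eta hG hf).symm)⟩

end Extension

end LOrder

namespace LCPos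

variable {L : Type u} [Order.Frame L]

/-- The directed completion `pt_L σ_L(P)` of a continuous `L`-ordered set `P`, the value at `P` of
the reflector. The carrier of `P` lives in `max u v` because `pt_L σ_L(P)` consists of functions
into `L : Type u`. -/
def completion (P : LCPos.{u, max u v} L) : LCDom.{u, max u v} L :=
  ⟨⟨P.order.scott.Pt, P.order.scott.ptOrder, P.continuous.isContinuous_ptOrder⟩,
    P.order.scott.isDcpo_ptOrder⟩

/-- The map `η_P : P → pt_L σ_L(P)` as a morphism, the unit of the reflection. -/
def toCompletion (P : LCPos.{u, max u v} L) : P ⟶ P.completion.obj :=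
  Hom.mk P.order.scott.eta P.order.scottContinuous_eta

/-- The universal property of the directed completion as a bijection of hom-sets. -/
noncomputable def completionHomEquiv (P : LCPos.{u, max u v} L) (M : LCDom.{u, max u v} L) :
    (P.completion ⟶ M) ≃ (P ⟶ (LCDom.inclusion.{u, max u v} L).obj M) where
  toFun g := P.toCompletion ≫ g.hom
  invFun f := ObjectProperty.homMk <|
    Hom.mk _ (P.continuous.scottContinuous_extension M.property f.scottContinuous)
  left_inv g := by
    have hg := (P.toCompletion ≫ g.hom).scottContinuous
    exact ObjectProperty.hom_ext _ <| Hom.ext <|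
      P.continuous.scottContinuous_ext (P.continuous.scottContinuous_extension M.property hg)
        g.hom.scottContinuous (P.continuous.extension_comp_eta M.property hg)
  right_inv f := Hom.ext (P.continuous.extension_comp_eta M.property f.scottContinuous)

theorem nonempty_reflective_inclusion : Nonempty (Reflective (LCDom.inclusion.{u, max u v} L)) :=
  ⟨{ L := _
     adj := Adjunction.adjunctionOfEquivLeft completionHomEquiv
       fun _ _ _ _ _ => rfl }⟩

end LCPos

theorem mainTheorem3_general (L : Type u) [Order.Frame L] :
    (∀ (P : Type v) (E : LOrder L P), E.IsContinuous →
      E.scott.ptOrder.IsContinuous ∧ E.scott.ptOrder.IsDcpo ∧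
        E.ScottContinuous E.scott.ptOrder E.scott.eta ∧
        ∀ (M : Type w) (G : LOrder L M), G.IsDcpo → ∀ f : P → M, E.ScottContinuous G f →
          ∃! g : E.scott.Pt → M, E.scott.ptOrder.ScottContinuous G g ∧ g ∘ E.scott.eta = f) ∧
    Nonempty (Reflective (LCDom.inclusion.{u, max u v} L)) :=
  ⟨fun _ E hE => ⟨hE.isContinuous_ptOrder, E.scott.isDcpo_ptOrder, E.scottContinuous_eta,
    fun _ _ hG _ hf => hE.existsUnique_extension hG hf⟩, LCPos.nonempty_reflective_inclusion⟩

theorem mainTheorem3 (L : Type u) [Order.Frame L] :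
    (∀ (P : Type v) (E : LOrder L P), E.IsContinuous →
      LOrder.IsDirectedCompletion.{w} E E.scott.ptOrder E.scott.eta) ∧
    Nonempty (Reflective (LCDom.inclusion.{u, max u v} L)) :=
  (mainTheorem3_general.{u, v, w} L).imp_left fun h P E hE =>
    (h P E hE).imp_right <| .imp_right <| .imp_right fun hext M G _ => hext M G
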